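/- Let $p$ be a prime and let $L$ be a finite extension of $\mathbb{Q}_p$, with valuation ring $\mathcal{O}_L$ (the integral closure of $\mathbb{Z}_p$ in $L$). Let $Th(L)$ be the set of all first-order sentences in the language of rings that are true in $L$. Formulas below are formulas of the language of rings without parameters, and for a field $K$ and a formula $\psi(x)$ in one free variable, $\psi(K)$ denotes the subset of $K$ defined by $\psi$. There is an existential formula $\psi(x)$ with $\psi(L)=\mathcal{O}_L$. Moreover, for any formula $\psi(x)$ with $\psi(L)=\mathcal{O}_L$, and with $\mathcal{O}_K:=\psi(K)$ for every model $K$ of $Th(L)$, the following hold. 1. For every model $K$ of $Th(L)$, the set $\mathcal{O}_K$ is a valuation ring of $K$. 2. For every embedding $K_1\to K_2$ of models of $Th(L)$ (with $K_1$ identified with its image): (a) $K_1$ is relatively algebraically closed in $K_2$; (b) the valuation ring $\mathcal{O}_{K_2}\cap K_1$ of $K_1$ induced from $\mathcal{O}_{K_2}$ is Henselian; (c) $\mathcal{O}_{K_2}\cap K_1=\mathcal{O}_{K_1}$. 3. The valuation rings are uniformly $\forall_1$-definable: there is a universal formula $\theta(x)$ such that $\theta(K)=\mathcal{O}_K$ for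 every model $K$ of $Th(L)$. -/

import Mathlib

open FirstOrder FirstOrder.Language FirstOrder.Ring

namespace PadicFieldTheory

/-- The valuation ring `𝒪_L` of a finite extension `L` of `ℚ_p`, as a subset of `L`:
the integral closure of `ℤ_p` in `L`. -/
def valRing (p : ℕ) [Fact p.Prime] (L : Type*) [Field L] [Algebra ℚ_[p] L] : Set L :=
  {x | ((algebraMap ℚ_[p] L).comp (algebraMap ℤ_[p] ℚ_[p])).IsIntegralElem x}

/-- The subset `ψ(K)` of a ring `K` defined, without parameters, by a formula `ψ(x)` of the
language of rings in one free variable. -/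
def definedSet (ψ : Language.ring.Formula (Fin 1)) (K : Type*) [Language.ring.Structure K] :
    Set K :=
  {x | ψ.Realize (fun _ => x)}

end PadicFieldTheory

/-!
Let `O` be the valuation ring of `L`, let `d` be the degree of `L` over `ℚ_p`, and let `n` be a
prime larger than `p` and `d`. An element of `L` is in `O` if and only if its norm is in `ℤ_p`, and
`v` denotes the valuation of the norm.

*Definability.* By Hensel's lemma `1 + p * x ^ n` is an `n`-th power for `x` in `O`; for other `x`
it has valuation `d + n * v(x)`, which is not divisible by `n`. This is an existential definition
of `O` without parameters (`mem_integerRing_iff_exists`). An element `x ≠ 0` is outside `O` if and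
only if `x ^ (-d) / p` is in `O`, which gives a universal one (`mem_integerRing_iff_forall`).

*Transfer.* `IsPadicLike` collects first-order properties of the pair `(L, O)`. They hold for every
model `K` of `Th(L)` with the subset defined by the same formula (`IsPadicLike.transfer`). Besides
the two definitions of `O` and the axioms of a valuation ring, these are: a monic irreducible
polynomial with integral constant coefficient has integral coefficients; every nonzero element is
an `m`-th power up to a factor of valuation between `0` and that of `p ^ m`; there is a fixed
finite number of residue classes modulo `p ^ k`; and a positive integer `m` is not divisible by
`p ^ m`.

*Consequences.* The existential definition goes up along an embedding `K₁ → K₂` and the universal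
one goes down, so that the valuation rings are compatible. The property of irreducible polynomials
implies that the integral closure of `O` in a finite extension consists of the elements with norm
in `O` (`ConstantCoeffProperty.isIntegral_iff`), and hence that `O` is Henselian
(`ConstantCoeffProperty.henselianLocalRing`). For relative algebraic closedness, an element of `K₂`
algebraic over `K₁` may be translated to have trace zero. If it is not zero, it may be scaled by an
element of `K₁` so that it is integral and divides `p`. Since `K₁` and `K₂` have equally many
residue classes modulo `p ^ k`, it is congruent to some `r` in `K₁` modulo `p ^ k`, and the trace
of the difference shows that `p ^ k` divides `m * r`, where `m` is the degree and `r` divides `p`.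
This is absurd for `k = m + 1` (`IsPadicLike.eq_zero_of_trace_eq_zero`).
-/

namespace PadicFieldTheory

open Polynomial

/-! ### First-order transfer -/

/-- The formula expressing that the value of the polynomial expression `t` satisfies `ψ`. -/
noncomputable def memFormula {α : Type*} (ψ : Language.ring.Formula (Fin 1))
    (t : FreeCommRing α) : Language.ring.Formula α :=
  BoundedFormula.subst ψ fun _ => termOfFreeCommRing t

/-- The formula expressing that two polynomial expressions have the same value. -/
noncomputable def eqFormula {α : Type*} (s t : FreeCommRing α) : Language.ring.Formula α :=
  Term.equal (termOfFreeCommRing s) (termOfFreeCommRing t)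

/-- The formula expressing that a polynomial with generic coefficients specializes to zero. -/
noncomputable def polyZeroFormula {α : Type*} (P : (FreeCommRing α)[X]) :
    Language.ring.Formula α :=
  Formula.iInf fun k : Fin (P.natDegree + 1) => eqFormula (P.coeff k) 0

section Realize

variable {α : Type*} {K : Type*} [Field K] [CompatibleRing K]

@[simp]
theorem realize_memFormula (ψ : Language.ring.Formula (Fin 1)) (t : FreeCommRing α) (v : α → K) :
    (memFormula ψ t).Realize v ↔ FreeCommRing.lift v t ∈ definedSet ψ K := by
  simp only [memFormula, Formula.Realize, BoundedFormula.realize_subst, definedSet,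
    Set.mem_ofPred_eq, realize_termOfFreeCommRing]

@[simp]
theorem realize_eqFormula (s t : FreeCommRing α) (v : α → K) :
    (eqFormula s t).Realize v ↔ FreeCommRing.lift v s = FreeCommRing.lift v t := by
  simp only [eqFormula, Formula.realize_equal, realize_termOfFreeCommRing]

@[simp]
theorem realize_polyZeroFormula (P : (FreeCommRing α)[X]) (v : α → K) :
    (polyZeroFormula P).Realize v ↔ P.map (FreeCommRing.lift v) = 0 := by
  simp only [polyZeroFormula, Formula.realize_iInf, realize_eqFormula, map_zero]
  constructor
  · intro h
    ext k
    rw [coeff_map, coeff_zero]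
    by_cases hk : k < P.natDegree + 1
    · exact h ⟨k, hk⟩
    · rw [coeff_eq_zero_of_natDegree_lt (by omega), map_zero]
  · intro h k
    rw [← coeff_map, h, coeff_zero]

end Realize

theorem realize_iAlls_relabel_inr {α M : Type*} [Finite α] [Language.ring.Structure M]
    (φ : Language.ring.Formula α) :
    M ⊨ (Formula.iAlls α (φ.relabel (Sum.inr : α → Empty ⊕ α)) : Language.ring.Sentence) ↔
      ∀ v : α → M, φ.Realize v := by
  simp [Sentence.Realize, Formula.realize_iAlls, Formula.realize_relabel, Function.comp_def]

/-- A formula that holds identically in `L` holds identically in every model of `Th(L)`. -/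
theorem realize_of_models {L K : Type*} [Field L] [CompatibleRing L] [Field K] [CompatibleRing K]
    (hK : K ⊨ Language.ring.completeTheory L) {α : Type} [Finite α]
    (φ : Language.ring.Formula α) (h : ∀ v : α → L, φ.Realize v) (v : α → K) : φ.Realize v :=
  (realize_iAlls_relabel_inr φ).1
    (hK.realize_of_mem _ ((realize_iAlls_relabel_inr φ).2 h)) v

/-- First-order properties of the valuation ring of a finite extension of `ℚ_p` of degree `d`,
stated for an arbitrary subset `O` of a field `K`. Here `n` stands for a prime exponent larger than
`p` and `d`, and `N k` for the number of residue classes modulo `p ^ k`. -/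
structure IsPadicLike (p n d : ℕ) (N : ℕ → ℕ) (K : Type*) [Field K] (O : Set K) : Prop where
  one_mem : (1 : K) ∈ O
  neg_mem : ∀ x ∈ O, -x ∈ O
  add_mem : ∀ x ∈ O, ∀ y ∈ O, x + y ∈ O
  mul_mem : ∀ x ∈ O, ∀ y ∈ O, x * y ∈ O
  mem_or_mem : ∀ x y : K, x * y = 1 → x ∈ O ∨ y ∈ O
  mem_iff_exists : ∀ x : K, x ∈ O ↔ ∃ z : K, z ^ n = 1 + p * x ^ n
  mem_iff_forall : ∀ x : K, x ∈ O ↔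
    ∀ w : K, ¬ (p ^ (n - 1) * w ^ n = 1 + p ^ (n - 1) * x ^ (d * n))
  /-- A monic polynomial of degree `m + 1` with constant coefficient in `O` has all its coefficients
  in `O` or is a product of two polynomials of smaller degree. -/
  mem_or_factor : ∀ (m : ℕ) (c : Fin (m + 1) → K), c 0 ∈ O →
    (∀ i, c i ∈ O) ∨ ∃ g h : Fin (m + 1) → K,
      (X ^ (m + 1) + ∑ i, C (c i) * X ^ (i : ℕ) : K[X]) =
        (∑ i, C (g i) * X ^ (i : ℕ)) * ∑ i, C (h i) * X ^ (i : ℕ)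
  /-- Both `s / t ^ (m + 1)` and `p ^ (m + 1) * t ^ (m + 1) / s` are in `O`. -/
  exists_root_approx : ∀ (m : ℕ) (s : K), s ≠ 0 →
    ∃ t y z : K, t ≠ 0 ∧ y ∈ O ∧ z ∈ O ∧ y * t ^ (m + 1) = s ∧
      z * s = p ^ (m + 1) * t ^ (m + 1)
  /-- The elements `r i` represent the classes of `O` modulo `p ^ k`, each of them once. -/
  residues : ∀ k : ℕ, ∃ r : Fin (N k) → K, (∀ i, r i ∈ O) ∧
    (∀ i j, i ≠ j → ∀ y ∈ O, p ^ k * y ≠ r i - r j) ∧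
    ∀ x ∈ O, ∃ i, ∃ y ∈ O, p ^ k * y = x - r i
  pow_mul_ne : ∀ m : ℕ, 0 < m → ∀ y ∈ O, (p : K) ^ m * y ≠ m

open FreeCommRing in
/-- Each of the properties is the validity of a formula, so it passes to all models of `Th(L)`. -/
theorem IsPadicLike.transfer {p n d : ℕ} {N : ℕ → ℕ} {L K : Type*} [Field L] [CompatibleRing L]
    [Field K] [CompatibleRing K] (hK : K ⊨ Language.ring.completeTheory L)
    {ψ : Language.ring.Formula (Fin 1)} (h : IsPadicLike p n d N L (definedSet ψ L)) :
    IsPadicLike p n d N K (definedSet ψ K) where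
  one_mem := by
    have := realize_of_models hK (α := Fin 0) (memFormula ψ 1) (fun v => by simpa using h.one_mem)
      Fin.elim0
    simpa using this
  neg_mem x := by
    have := realize_of_models hK (α := Fin 1)
      ((memFormula ψ (of 0)).imp (memFormula ψ (-of 0)))
      (fun v => by simpa using h.neg_mem (v 0)) ![x]
    simpa using this
  add_mem x hx y := by
    have := realize_of_models hK (α := Fin 2)
      ((memFormula ψ (of 0)).imp ((memFormula ψ (of 1)).imp (memFormula ψ (of 0 + of 1))))
      (fun v => by simpa using fun h0 => h.add_mem (v 0) h0 (v 1)) ![x, y]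
    simpa [hx] using this
  mul_mem x hx y := by
    have := realize_of_models hK (α := Fin 2)
      ((memFormula ψ (of 0)).imp ((memFormula ψ (of 1)).imp (memFormula ψ (of 0 * of 1))))
      (fun v => by simpa using fun h0 => h.mul_mem (v 0) h0 (v 1)) ![x, y]
    simpa [hx] using this
  mem_or_mem x y := by
    have := realize_of_models hK (α := Fin 2)
      ((eqFormula (of 0 * of 1) 1).imp (memFormula ψ (of 0) ⊔ memFormula ψ (of 1)))
      (fun v => by simpa using h.mem_or_mem (v 0) (v 1)) ![x, y]
    simpa using this
  mem_iff_exists x := by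
    have := realize_of_models hK (α := Fin 1)
      ((memFormula ψ (of 0)).iff (Formula.iExs (Fin 1)
        (eqFormula (of (Sum.inr 0) ^ n) (1 + (p : FreeCommRing _) * of (Sum.inl 0) ^ n))))
      (fun v => by simpa [Fin.exists_fin_succ_pi] using h.mem_iff_exists (v 0)) ![x]
    simpa [Fin.exists_fin_succ_pi] using this
  mem_iff_forall x := by
    have := realize_of_models hK (α := Fin 1)
      ((memFormula ψ (of 0)).iff (Formula.iAlls (Fin 1) (Formula.not
        (eqFormula ((p : FreeCommRing _) ^ (n - 1) * of (Sum.inr 0) ^ n)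
          (1 + (p : FreeCommRing _) ^ (n - 1) * of (Sum.inl 0) ^ (d * n))))))
      (fun v => by simpa [Fin.forall_fin_succ_pi] using h.mem_iff_forall (v 0)) ![x]
    simpa [Fin.forall_fin_succ_pi] using this
  mem_or_factor m c := by
    have := realize_of_models hK (α := Fin (m + 1))
      ((memFormula ψ (of 0)).imp
        ((Formula.iInf fun i => memFormula ψ (of i)) ⊔
          (Formula.iExs (Fin (m + 1) ⊕ Fin (m + 1)) (polyZeroFormula
            ((X ^ (m + 1) + ∑ i : Fin (m + 1), C (of (Sum.inl i)) * X ^ (i : ℕ)) -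
              (∑ i : Fin (m + 1), C (of (Sum.inr (Sum.inl i))) * X ^ (i : ℕ)) *
                ∑ i : Fin (m + 1), C (of (Sum.inr (Sum.inr i))) * X ^ (i : ℕ))))))
      (fun v => by
        simp only [Formula.realize_imp, Formula.realize_sup, Formula.realize_iInf,
          Formula.realize_iExs, realize_memFormula, realize_polyZeroFormula, lift_of]
        intro h0
        refine (h.mem_or_factor m v h0).imp id ?_
        rintro ⟨g, k, hgk⟩
        refine ⟨Sum.elim g k, ?_⟩
        simpa [Polynomial.map_sum, sub_eq_zero] using hgk) c
    simp only [Formula.realize_imp, Formula.realize_sup, Formula.realize_iInf,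
      Formula.realize_iExs, realize_memFormula, realize_polyZeroFormula, lift_of] at this
    intro h0
    refine (this h0).imp id ?_
    rintro ⟨i, hi⟩
    refine ⟨fun k => i (Sum.inl k), fun k => i (Sum.inr k), ?_⟩
    simpa [Polynomial.map_sum, sub_eq_zero] using hi
  exists_root_approx m s := by
    have := realize_of_models hK (α := Fin 1)
      ((eqFormula (of 0) 0).not.imp (Formula.iExs (Fin 3)
        ((eqFormula (of (Sum.inr 0)) 0).not ⊓ (memFormula ψ (of (Sum.inr 1)) ⊓
          (memFormula ψ (of (Sum.inr 2)) ⊓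
            (eqFormula (of (Sum.inr 1) * of (Sum.inr 0) ^ (m + 1)) (of (Sum.inl 0)) ⊓
              eqFormula (of (Sum.inr 2) * of (Sum.inl 0))
                ((p : FreeCommRing _) ^ (m + 1) * of (Sum.inr 0) ^ (m + 1))))))))
      (fun v => by
        simpa [Fin.exists_fin_succ_pi] using h.exists_root_approx m (v 0)) ![s]
    simpa [Fin.exists_fin_succ_pi] using this
  residues k := by
    have := realize_of_models hK (α := Fin 0)
      (Formula.iExs (Fin (N k))
        ((Formula.iInf fun i => memFormula ψ (of (Sum.inr i))) ⊓
          ((Formula.iInf fun ij : {ij : Fin (N k) × Fin (N k) // ij.1 ≠ ij.2} =>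
            Formula.iAlls (Fin 1) ((memFormula ψ (of (Sum.inr 0))).imp
              (eqFormula ((p : FreeCommRing _) ^ k * of (Sum.inr 0))
                (of (Sum.inl (Sum.inr ij.1.1)) - of (Sum.inl (Sum.inr ij.1.2)))).not)) ⊓
          Formula.iAlls (Fin 1) ((memFormula ψ (of (Sum.inr 0))).imp
            (Formula.iSup fun i => Formula.iExs (Fin 1)
              (memFormula ψ (of (Sum.inr 0)) ⊓ eqFormula ((p : FreeCommRing _) ^ k * of (Sum.inr 0))
                (of (Sum.inl (Sum.inr 0)) - of (Sum.inl (Sum.inl (Sum.inr i))))))))))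
      (fun v => by
        simpa [Fin.exists_fin_succ_pi, Fin.forall_fin_succ_pi] using h.residues k) Fin.elim0
    simpa [Fin.exists_fin_succ_pi, Fin.forall_fin_succ_pi] using this
  pow_mul_ne m hm y := by
    have := realize_of_models hK (α := Fin 1)
      ((memFormula ψ (of 0)).imp (eqFormula ((p : FreeCommRing _) ^ m * of 0) m).not)
      (fun v => by simpa using h.pow_mul_ne m hm (v 0)) ![y]
    simpa using this

/-! ### Valuation rings in which the constant coefficient controls irreducible polynomials -/

/-- A valuation ring `O` of `K` has the constant coefficient property if a monic irreducible
polynomial over `K` has all its coefficients in `O` as soon as its constant coefficient is in `O`.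
This is equivalent to `O` being Henselian, and it is first-order for each fixed degree. -/
def ConstantCoeffProperty {K : Type*} [Field K] (O : ValuationSubring K) : Prop :=
  ∀ f : K[X], f.Monic → Irreducible f → f.coeff 0 ∈ O → ∀ i, f.coeff i ∈ O

/-- The form of the property that is transferred between fields: a factorization into polynomials
of smaller degree is given by two tuples of coefficients. -/
theorem ConstantCoeffProperty.mem_or_factor {K : Type*} [Field K] {O : ValuationSubring K}
    (hO : ConstantCoeffProperty O) (m : ℕ) (c : Fin (m + 1) → K) (h0 : c 0 ∈ O) :
    (∀ i, c i ∈ O) ∨ ∃ g h : Fin (m + 1) → K,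
      (X ^ (m + 1) + ∑ i, C (c i) * X ^ (i : ℕ) : K[X]) =
        (∑ i, C (g i) * X ^ (i : ℕ)) * ∑ i, C (h i) * X ^ (i : ℕ) := by
  set f : K[X] := X ^ (m + 1) + ∑ i, C (c i) * X ^ (i : ℕ) with hf
  have hdeg : (∑ i, C (c i) * X ^ (i : ℕ) : K[X]).degree < (m + 1 : ℕ) := degree_sum_fin_lt c
  have hmon : f.Monic := monic_X_pow_add hdeg
  have hnat : f.natDegree = m + 1 := by
    rw [hf, natDegree_add_eq_left_of_degree_lt (by rwa [degree_X_pow]), natDegree_X_pow]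
  have hcoeff : ∀ i : Fin (m + 1), f.coeff i = c i := by
    intro i
    have h1 : (i : ℕ) ≠ m + 1 := i.2.ne
    simp [hf, coeff_X_pow, h1, coeff_C_mul, Fin.val_inj]
  by_cases hirr : Irreducible f
  · left
    intro i
    rw [← hcoeff]
    refine hO f hmon hirr ?_ _
    have := hcoeff 0
    rw [Fin.val_zero] at this
    rwa [this]
  · right
    have hne : f ≠ 1 := by
      intro h
      rw [h, natDegree_one] at hnat
      omega
    rw [hmon.irreducible_iff_natDegree] at hirr
    push Not at hirr
    obtain ⟨g, h, hg, hh, hgh, hg0, hh0⟩ := hirr hne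
    have hd : g.natDegree + h.natDegree = m + 1 := by
      rw [← hnat, ← hgh, hg.natDegree_mul hh]
    refine ⟨fun i => g.coeff i, fun i => h.coeff i, ?_⟩
    rw [Fin.sum_univ_eq_sum_range (fun i => C (g.coeff i) * X ^ i : ℕ → K[X]),
      Fin.sum_univ_eq_sum_range (fun i => C (h.coeff i) * X ^ i : ℕ → K[X]),
      ← as_sum_range_C_mul_X_pow' g (by omega), ← as_sum_range_C_mul_X_pow' h (by omega), hgh]

theorem mem_of_pow_mem {K : Type*} [Field K] (O : ValuationSubring K) {x : K}
    {k : ℕ} (hk : k ≠ 0) (h : x ^ k ∈ O) : x ∈ O := by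
  rw [← O.valuation_le_one_iff] at h ⊢
  rw [map_pow] at h
  exact (pow_le_one_iff hk).1 h

theorem norm_eq_coeff_zero_minpoly_pow {K F : Type*} [Field K] [Field F] [Algebra K F]
    [FiniteDimensional K F] (b : F) :
    ∃ k r : ℕ, r ≠ 0 ∧ Algebra.norm K b = ((-1) ^ k * (minpoly K b).coeff 0) ^ r := by
  refine ⟨(minpoly K b).natDegree, Module.finrank (IntermediateField.adjoin K {b}) F,
    (Module.finrank_pos).ne', ?_⟩
  · rw [Algebra.norm_eq_norm_adjoin K b,
      ← IntermediateField.adjoin.powerBasis_gen (Algebra.IsIntegral.isIntegral b),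
      Algebra.PowerBasis.norm_gen_eq_coeff_zero_minpoly,
      IntermediateField.adjoin.powerBasis_gen, IntermediateField.minpoly_gen,
      IntermediateField.adjoin.powerBasis_dim]

theorem norm_div {K F : Type*} [Field K] [Field F] [Algebra K F] [FiniteDimensional K F]
    (x y : F) : Algebra.norm K (x / y) = Algebra.norm K x / Algebra.norm K y := by
  rcases eq_or_ne y 0 with rfl | hy
  · simp [Algebra.norm_zero]
  · rw [eq_div_iff (Algebra.norm_ne_zero_iff.2 hy), ← map_mul, div_mul_cancel₀ _ hy]

theorem exists_finite_extension_root.{u} {K : Type u} [Field K] {g : K[X]} (hg : g.Monic)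
    (hirr : Irreducible g) :
    ∃ (F : Type u) (_ : Field F) (_ : Algebra K F) (a : F), FiniteDimensional K F ∧
      minpoly K a = g ∧ Module.finrank K F = g.natDegree ∧
      Algebra.norm K a = (-1) ^ g.natDegree * g.coeff 0 := by
  have : Fact (Irreducible g) := ⟨hirr⟩
  have hmin : minpoly K (AdjoinRoot.root g) = g := by
    simp [AdjoinRoot.minpoly_root hirr.ne_zero, hg.leadingCoeff]
  refine ⟨AdjoinRoot g, inferInstance, inferInstance, AdjoinRoot.root g,
    (AdjoinRoot.powerBasis hirr.ne_zero).finite, hmin, ?_, ?_⟩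
  · rw [(AdjoinRoot.powerBasis hirr.ne_zero).finrank, AdjoinRoot.powerBasis_dim]
  · have := Algebra.PowerBasis.norm_gen_eq_coeff_zero_minpoly
      (AdjoinRoot.powerBasis (f := g) hirr.ne_zero)
    rwa [AdjoinRoot.powerBasis_gen, AdjoinRoot.powerBasis_dim, hmin] at this

section Extension

variable {K F : Type*} [Field K] [Field F] [Algebra K F] {O : ValuationSubring K}

theorem neg_one_pow_mul_mem_iff (k : ℕ) (x : K) : (-1) ^ k * x ∈ O ↔ x ∈ O := by
  rcases neg_one_pow_eq_or K k with h | h <;> simp [h]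

theorem isIntegral_aeval {R F : Type*} [CommRing R] [CommRing F] [Algebra R F] {a : F}
    (ha : IsIntegral R a) (q : R[X]) : IsIntegral R (aeval a q) :=
  adjoin_le_integralClosure ha (aeval_mem_adjoin_singleton R a)

theorem mem_of_isIntegral {x : K} (h : IsIntegral O x) : x ∈ O := by
  obtain ⟨y, rfl⟩ := IsIntegrallyClosed.isIntegral_iff.1 h
  exact y.2

theorem isIntegral_of_minpoly_coeff_mem [FiniteDimensional K F] {b : F}
    (h : ∀ i, (minpoly K b).coeff i ∈ O) : IsIntegral O b := by
  have hl : minpoly K b ∈ lifts (algebraMap O K) := by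
    rw [lifts_iff_coeff_lifts]
    exact fun i => ⟨⟨_, h i⟩, rfl⟩
  obtain ⟨q, hq, -, hqm⟩ := lifts_and_degree_eq_and_monic hl
    (minpoly.monic (Algebra.IsIntegral.isIntegral b))
  refine ⟨q, hqm, ?_⟩
  rw [IsScalarTower.algebraMap_eq O K F, ← eval₂_map, hq]
  exact minpoly.aeval K b

/-- Under the constant coefficient property, the integral closure of `O` in a finite extension
consists of the elements with norm in `O`. -/
theorem ConstantCoeffProperty.isIntegral_iff [FiniteDimensional K F]
    (hO : ConstantCoeffProperty O) {b : F} : IsIntegral O b ↔ Algebra.norm K b ∈ O := by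
  constructor
  · intro h
    exact mem_of_isIntegral (Algebra.isIntegral_norm K h)
  · intro h
    obtain ⟨k, r, hr, hn⟩ := norm_eq_coeff_zero_minpoly_pow (K := K) b
    have hb := Algebra.IsIntegral.isIntegral (R := K) b
    rw [hn] at h
    refine isIntegral_of_minpoly_coeff_mem (hO _ (minpoly.monic hb) (minpoly.irreducible hb) ?_)
    exact (neg_one_pow_mul_mem_iff k _).1 (mem_of_pow_mem O hr h)

end Extension

section Hensel

variable {K : Type*} [Field K] {O : ValuationSubring K}

open IsLocalRing in
/-- If `f` were irreducible of degree `k ≥ 2` with root `a`, then `a ^ k / f(0)` would be integral,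
hence so would be `f(0) / a ^ 2`, and then `f'(0) / a`; but the norm of the latter is not in `O`. -/
theorem ConstantCoeffProperty.natDegree_le_one (hO : ConstantCoeffProperty O) {f : O[X]}
    (hf : f.Monic) (hirr : Irreducible f) (h0 : f.coeff 0 ∈ maximalIdeal O)
    (h1 : IsUnit (f.coeff 1)) : f.natDegree ≤ 1 := by
  by_contra! hk
  set g : K[X] := f.map (algebraMap O K) with hg
  have hgm : g.Monic := hf.map _
  have hgirr : Irreducible g := (hf.irreducible_iff_irreducible_map_fraction_map).1 hirr
  have hgdeg : g.natDegree = f.natDegree := hf.natDegree_map _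
  obtain ⟨F, _, _, a, _, hmin, hdim, hN⟩ := exists_finite_extension_root hgm hgirr
  set c₀ : K := (f.coeff 0 : K)
  set c₁ : K := (f.coeff 1 : K)
  set k := f.natDegree
  rw [hgdeg] at hdim hN
  have hN : Algebra.norm K a = (-1) ^ k * c₀ := by
    rw [hN, hg, coeff_map]
    rfl
  -- an irreducible polynomial of degree at least two has nonzero constant coefficient
  have ha0 : a ≠ 0 := by
    intro h
    rw [h, minpoly.zero] at hmin
    have := congrArg natDegree hmin
    rw [natDegree_X, hgdeg] at this
    omega
  have hc₀ : c₀ ≠ 0 := by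
    intro h
    rw [h, mul_zero] at hN
    exact ha0 (Algebra.norm_eq_zero_iff.1 hN)
  let ι := algebraMap K F
  have hint : IsIntegral O (ι c₀ / a ^ k) := by
    rw [hO.isIntegral_iff, norm_div, map_pow, hN, Algebra.norm_algebraMap, hdim, mul_pow,
      ← div_div, div_right_comm, div_self (pow_ne_zero _ hc₀), one_div, ← pow_mul]
    rcases neg_one_pow_eq_or K (k * k) with h | h <;> simp [h]
  have haint : IsIntegral O a := by
    rw [hO.isIntegral_iff, hN]
    exact (neg_one_pow_mul_mem_iff k _).2 (f.coeff 0).2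
  have hroot : ι c₀ + ι c₁ * a + a ^ 2 * aeval a (divX (divX f)) = 0 := by
    have h2 : aeval a f = 0 := by
      have : aeval a g = 0 := by rw [← hmin, minpoly.aeval]
      rwa [hg, aeval_map_algebraMap] at this
    have h3 : f = X * (X * divX (divX f) + C (f.coeff 1)) + C (f.coeff 0) := by
      conv_lhs => rw [← divX_mul_X_add f, ← divX_mul_X_add (divX f)]
      simp only [coeff_divX]
      ring
    rw [h3] at h2
    simp only [map_add, map_mul, aeval_X, aeval_C] at h2
    rw [IsScalarTower.algebraMap_apply O K F,
      IsScalarTower.algebraMap_apply O K F] at h2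
    rw [← h2]
    simp only [ι, c₀, c₁, ValuationSubring.algebraMap_apply]
    ring
  have hq : IsIntegral O (ι c₁ / a) := by
    have : ι c₁ / a = -(ι c₀ / a ^ k * a ^ (k - 2) + aeval a (divX (divX f))) := by
      have h2 : a ^ k = a ^ 2 * a ^ (k - 2) := by rw [← pow_add]; congr 1; omega
      rw [h2]
      field_simp
      linear_combination hroot
    rw [this]
    exact ((hint.mul (haint.pow _)).add (isIntegral_aeval haint _)).neg
  rw [hO.isIntegral_iff, norm_div, hN, Algebra.norm_algebraMap, hdim] at hq
  have h5 : c₁ ^ k / c₀ ∈ O := by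
    rcases neg_one_pow_eq_or K k with h | h
    · simpa [h] using hq
    · rw [h, neg_one_mul, div_neg] at hq
      simpa using O.neg_mem _ hq
  have h6 : O.valuation c₁ = 1 := (O.valuation_eq_one_iff _).1 h1
  have h7 : O.valuation c₀ < 1 := (O.valuation_lt_one_iff _).1 h0
  rw [← O.valuation_le_one_iff, map_div₀, map_pow, h6, one_pow, one_div] at h5
  have h8 : O.valuation c₀ ≠ 0 := by simpa using hc₀
  exact absurd h5 (not_le.2 ((one_lt_inv₀ (zero_lt_iff.2 h8)).2 h7))

open IsLocalRing in
theorem ConstantCoeffProperty.exists_root_mem_maximalIdeal (hO : ConstantCoeffProperty O)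
    (k : ℕ) : ∀ f : O[X], f.natDegree = k → f.Monic → f.coeff 0 ∈ maximalIdeal O →
      IsUnit (f.coeff 1) → ∃ a ∈ maximalIdeal O, f.eval a = 0 := by
  induction k using Nat.strong_induction_on with
  | _ k ih =>
    intro f hk hf h0 h1
    have hf1 : f ≠ 1 := by
      rintro rfl
      simp at h0
    by_cases hirr : Irreducible f
    · have hd := hO.natDegree_le_one hf hirr h0 h1
      have hd' : f.natDegree = 1 := by
        refine le_antisymm hd (Nat.one_le_iff_ne_zero.2 fun h => ?_)
        exact hf1 (hf.natDegree_eq_zero.1 h)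
      refine ⟨-f.coeff 0, neg_mem h0, ?_⟩
      rw [hf.eq_X_add_C hd']
      simp
    · rw [hf.irreducible_iff_natDegree] at hirr
      push Not at hirr
      obtain ⟨g, h, hg, hh, hgh, hg0, hh0⟩ := hirr hf1
      have hdeg : g.natDegree + h.natDegree = k := by
        rw [← hk, ← hgh, hg.natDegree_mul hh]
      -- exactly one factor vanishes at `0` modulo the maximal ideal
      have aux : ∀ u v : O[X], u * v = f → u.Monic → u.natDegree < k →
          u.coeff 0 ∈ maximalIdeal O → ∃ a ∈ maximalIdeal O, f.eval a = 0 := by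
        intro u v huv hu hud hu0
        have hu1 : IsUnit (u.coeff 1) := by
          rw [← huv, mul_coeff_one] at h1
          by_contra hcon
          have : u.coeff 0 * v.coeff 1 + u.coeff 1 * v.coeff 0 ∈ maximalIdeal O :=
            add_mem (Ideal.mul_mem_right _ _ hu0)
              (Ideal.mul_mem_right _ _ ((mem_maximalIdeal _).2 hcon))
          exact (mem_maximalIdeal _).1 this h1
        obtain ⟨a, ha, hroot⟩ := ih _ hud u rfl hu hu0 hu1
        exact ⟨a, ha, by rw [← huv, eval_mul, hroot, zero_mul]⟩
      have h2 : g.coeff 0 * h.coeff 0 ∈ maximalIdeal O := by rwa [← mul_coeff_zero, hgh]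
      rcases (maximalIdeal.isMaximal O).isPrime.mem_or_mem h2 with h3 | h3
      · exact aux g h hgh hg (by omega) h3
      · exact aux h g (by rw [mul_comm, hgh]) hh (by omega) h3

theorem ConstantCoeffProperty.henselianLocalRing (hO : ConstantCoeffProperty O) :
    HenselianLocalRing O where
  is_henselian f hf a₀ h0 h1 := by
    obtain ⟨a, ha, hroot⟩ := hO.exists_root_mem_maximalIdeal _ (taylor a₀ f) rfl
      (by rw [Monic, leadingCoeff_taylor]; exact hf) (by rwa [taylor_coeff_zero])
      (by rwa [taylor_coeff_one])
    exact ⟨a + a₀, by rwa [taylor_eval] at hroot, by simpa using ha⟩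

end Hensel

/-! ### Consequences of the first-order properties -/

section Single

variable {p n d : ℕ} {N : ℕ → ℕ} {K : Type*} [Field K]

theorem IsPadicLike.exists_valuationSubring {O : Set K} (h : IsPadicLike p n d N K O) :
    ∃ V : ValuationSubring K, (V : Set K) = O := by
  have hz : (0 : K) ∈ O := by
    simpa using h.add_mem _ h.one_mem _ (h.neg_mem _ h.one_mem)
  refine ⟨{ carrier := O, one_mem' := h.one_mem, zero_mem' := hz,
            mul_mem' := fun hx hy => h.mul_mem _ hx _ hy,
            add_mem' := fun hx hy => h.add_mem _ hx _ hy,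
            neg_mem' := fun hx => h.neg_mem _ hx,
            mem_or_inv_mem' := fun x => ?_ }, rfl⟩
  rcases eq_or_ne x 0 with rfl | hx
  · exact Or.inl hz
  · exact h.mem_or_mem x x⁻¹ (mul_inv_cancel₀ hx)

variable {O : ValuationSubring K}

theorem IsPadicLike.constantCoeffProperty (h : IsPadicLike p n d N K O) :
    ConstantCoeffProperty O := by
  intro f hf hirr h0
  obtain ⟨m, hm⟩ : ∃ m, f.natDegree = m + 1 :=
    Nat.exists_eq_succ_of_ne_zero fun h0 => by
      rw [hf.natDegree_eq_zero.1 h0] at hirr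
      exact not_irreducible_one hirr
  rcases h.mem_or_factor m (fun i => f.coeff i) h0 with h1 | ⟨g, k, hgk⟩
  · intro i
    rcases lt_trichotomy i (m + 1) with hi | rfl | hi
    · exact h1 ⟨i, hi⟩
    · rw [← hm, hf.coeff_natDegree]
      exact O.one_mem
    · rw [coeff_eq_zero_of_natDegree_lt (by omega)]
      exact O.zero_mem
  · exfalso
    rw [Fin.sum_univ_eq_sum_range (fun i => C (f.coeff i) * X ^ i : ℕ → K[X])] at hgk
    have hsum := hf.as_sum
    rw [hm] at hsum
    rw [← hsum] at hgk
    have hdeg : ∀ g : Fin (m + 1) → K,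
        (∑ i, C (g i) * X ^ (i : ℕ) : K[X]).natDegree ≤ m := fun g =>
      natDegree_sum_le_of_forall_le _ _ fun i _ =>
        (natDegree_C_mul_X_pow_le _ _).trans (Nat.lt_succ_iff.1 i.2)
    rw [hgk] at hirr
    rcases hirr.isUnit_or_isUnit rfl with hu | hu
    · have := natDegree_mul_le (p := ∑ i, C (g i) * X ^ (i : ℕ))
        (q := ∑ i, C (k i) * X ^ (i : ℕ))
      rw [← hgk, natDegree_eq_zero_of_isUnit hu] at this
      have := hdeg k
      omega
    · have := natDegree_mul_le (p := ∑ i, C (g i) * X ^ (i : ℕ))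
        (q := ∑ i, C (k i) * X ^ (i : ℕ))
      rw [← hgk, natDegree_eq_zero_of_isUnit hu] at this
      have := hdeg g
      omega

theorem IsPadicLike.charZero (h : IsPadicLike p n d N K O) : CharZero K :=
  charZero_of_inj_zero fun m hm => by
    by_contra h0
    exact h.pow_mul_ne m (Nat.pos_of_ne_zero h0) 0 O.zero_mem (by rw [hm, mul_zero])

theorem IsPadicLike.valuation_prime_lt_one (h : IsPadicLike p n d N K O) :
    O.valuation (p : K) < 1 := by
  by_contra! hp
  have hp0 : (p : K) ≠ 0 := by
    rintro h0
    simp [h0] at hp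
  have h1 : (p : K)⁻¹ ∈ O := by
    rw [← O.valuation_le_one_iff, map_inv₀]
    exact inv_le_one_of_one_le₀ hp
  exact h.pow_mul_ne 1 one_pos _ h1 (by rw [pow_one, mul_inv_cancel₀ hp0, Nat.cast_one])

end Single

section Pair

variable {p n d : ℕ} {N : ℕ → ℕ} {K₁ K₂ : Type*} [Field K₁] [Field K₂] [Algebra K₁ K₂]

/-- The existential description of the valuation ring goes up along an embedding, and the universal
one goes down. -/
theorem IsPadicLike.algebraMap_mem_iff {O₁ : Set K₁} {O₂ : Set K₂}
    (h₁ : IsPadicLike p n d N K₁ O₁) (h₂ : IsPadicLike p n d N K₂ O₂) (x : K₁) :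
    algebraMap K₁ K₂ x ∈ O₂ ↔ x ∈ O₁ := by
  constructor
  · rw [h₁.mem_iff_forall, h₂.mem_iff_forall]
    intro h w hw
    refine h (algebraMap K₁ K₂ w) ?_
    simpa using congrArg (algebraMap K₁ K₂) hw
  · rw [h₁.mem_iff_exists, h₂.mem_iff_exists]
    rintro ⟨z, hz⟩
    exact ⟨algebraMap K₁ K₂ z, by simpa using congrArg (algebraMap K₁ K₂) hz⟩

variable {O₁ : ValuationSubring K₁} {O₂ : ValuationSubring K₂}

theorem algebraMap_mem_of_isIntegral {F : Type*} [Field F] [Algebra K₁ F] [Algebra F K₂]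
    [IsScalarTower K₁ F K₂] (hO : ∀ x : K₁, x ∈ O₁ → algebraMap K₁ K₂ x ∈ O₂) {b : F}
    (hb : IsIntegral O₁ b) : algebraMap F K₂ b ∈ O₂ := by
  obtain ⟨q, hq, hroot⟩ := hb
  let φ : O₁ →+* O₂ := ((algebraMap K₁ K₂).comp O₁.subtype).codRestrict O₂ fun x => hO x x.2
  refine mem_of_isIntegral ⟨q.map φ, hq.map φ, ?_⟩
  have hφ : (algebraMap O₂ K₂).comp φ = (algebraMap F K₂).comp (algebraMap O₁ F) := by
    ext x
    exact IsScalarTower.algebraMap_apply K₁ F K₂ x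
  rw [eval₂_map, hφ, ← hom_eval₂, hroot, map_zero]

/-- The valuation ring of an extension field induces on a finite subextension the integral closure
of the valuation ring below: an element `b` of degree `m` agrees in valuation with the `m`-th root
of its norm, because `b ^ m / N(b)` has norm one. -/
theorem isIntegral_of_algebraMap_mem {F : Type*} [Field F] [Algebra K₁ F] [Algebra F K₂]
    [IsScalarTower K₁ F K₂] [FiniteDimensional K₁ F] (hO₁ : ConstantCoeffProperty O₁)
    (hO : ∀ x : K₁, algebraMap K₁ K₂ x ∈ O₂ ↔ x ∈ O₁) {b : F}
    (hb : algebraMap F K₂ b ∈ O₂) : IsIntegral O₁ b := by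
  rcases eq_or_ne b 0 with rfl | hb0
  · exact isIntegral_zero
  set s := Algebra.norm K₁ b with hs
  have hs0 : s ≠ 0 := Algebra.norm_ne_zero_iff.2 hb0
  set m := Module.finrank K₁ F
  have hu : IsIntegral O₁ (algebraMap K₁ F s / b ^ m) := by
    rw [hO₁.isIntegral_iff, norm_div, map_pow, Algebra.norm_algebraMap, ← hs,
      div_self (pow_ne_zero _ hs0)]
    exact O₁.one_mem
  have hu' := algebraMap_mem_of_isIntegral (fun x hx => (hO x).2 hx) hu
  rw [hO₁.isIntegral_iff, ← hO, IsScalarTower.algebraMap_apply K₁ F K₂]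
  have h1 : algebraMap K₁ F s = b ^ m * (algebraMap K₁ F s / b ^ m) := by
    field_simp
  rw [h1, map_mul, map_pow]
  exact O₂.mul_mem _ _ (pow_mem hb m) hu'

/-- Both valuation rings have the same finite number of residue classes modulo `p ^ k`, so that
representatives of the classes of the smaller ring represent those of the larger one. -/
theorem IsPadicLike.exists_residue [Fact p.Prime] (h₁ : IsPadicLike p n d N K₁ O₁)
    (h₂ : IsPadicLike p n d N K₂ O₂) (k : ℕ) {x : K₂} (hx : x ∈ O₂) :
    ∃ r ∈ O₁, ∃ w ∈ O₂, (p : K₂) ^ k * w = x - algebraMap K₁ K₂ r := by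
  have := h₁.charZero
  have hp : (p : K₁) ^ k ≠ 0 := pow_ne_zero _ (by exact_mod_cast (Fact.out : p.Prime).ne_zero)
  obtain ⟨r, hr, hne, -⟩ := h₁.residues k
  obtain ⟨r', -, -, hcov⟩ := h₂.residues k
  choose f y hy hf using fun i => hcov _ ((h₁.algebraMap_mem_iff h₂ (r i)).2 (hr i))
  have hinj : Function.Injective f := by
    intro i j hij
    by_contra hcon
    have hmap : algebraMap K₁ K₂ ((r i - r j) / p ^ k) = y i - y j := by
      have hp2 : (p : K₂) ^ k ≠ 0 := by
        simpa using (_root_.map_ne_zero (algebraMap K₁ K₂)).2 hp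
      have h1 := hf i
      have h2 := hf j
      rw [hij] at h1
      rw [map_div₀, map_sub, map_pow, map_natCast, div_eq_iff hp2]
      linear_combination h2 - h1
    refine hne i j hcon ((r i - r j) / p ^ k) ?_ (mul_div_cancel₀ _ hp)
    refine (h₁.algebraMap_mem_iff h₂ _).1 ?_
    rw [hmap]
    exact O₂.toSubring.sub_mem (hy i) (hy j)
  obtain ⟨j, z, hz, hjz⟩ := hcov x hx
  obtain ⟨i, rfl⟩ := Finite.surjective_of_injective hinj j
  refine ⟨r i, hr i, z - y i, O₂.toSubring.sub_mem hz (hy i), ?_⟩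
  linear_combination hjz - hf i

/-- An element `b` of trace zero in a finite subextension vanishes. Otherwise, after scaling by an
element of `K₁`, it is integral and divides `p`; approximating it by an element `r` of `K₁` modulo a
high power of `p` and taking traces shows that the degree is divisible by too high a power
of `p`. -/
theorem IsPadicLike.eq_zero_of_trace_eq_zero [Fact p.Prime] (h₁ : IsPadicLike p n d N K₁ O₁)
    (h₂ : IsPadicLike p n d N K₂ O₂) {F : Type*} [Field F] [Algebra K₁ F] [Algebra F K₂]
    [IsScalarTower K₁ F K₂] [FiniteDimensional K₁ F] {b : F} (hb : Algebra.trace K₁ F b = 0) :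
    b = 0 := by
  by_contra hb0
  have := h₁.charZero
  have := h₂.charZero
  have hO := h₁.algebraMap_mem_iff h₂
  have hcc := h₁.constantCoeffProperty
  have hp1 : (p : K₁) ≠ 0 := by exact_mod_cast (Fact.out : p.Prime).ne_zero
  have hp2 : (p : K₂) ≠ 0 := by exact_mod_cast (Fact.out : p.Prime).ne_zero
  have hpF : (p : F) ≠ 0 := by
    simpa using (_root_.map_ne_zero (algebraMap K₁ F)).2 hp1
  have hval := h₂.valuation_prime_lt_one
  obtain ⟨m, hm⟩ : ∃ m, Module.finrank K₁ F = m + 1 :=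
    Nat.exists_eq_succ_of_ne_zero Module.finrank_pos.ne'
  have hs0 : Algebra.norm K₁ b ≠ 0 := Algebra.norm_ne_zero_iff.2 hb0
  obtain ⟨t, y, z, ht, hy, hz, hty, htz⟩ := h₁.exists_root_approx m _ hs0
  have ht' : algebraMap K₁ F t ≠ 0 := (_root_.map_ne_zero _).2 ht
  set u : F := b / algebraMap K₁ F t with hu
  have hu0 : u ≠ 0 := div_ne_zero hb0 ht'
  have huint : IsIntegral O₁ u := by
    rw [hcc.isIntegral_iff, norm_div, Algebra.norm_algebraMap, hm, ← hty,
      mul_div_cancel_right₀ _ (pow_ne_zero _ ht)]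
    exact hy
  have hvint : IsIntegral O₁ ((p : F) / u) := by
    have h1 : (p : F) / u = algebraMap K₁ F (p * t) / b := by
      rw [hu, map_mul, map_natCast]
      field_simp
    rw [h1, hcc.isIntegral_iff, norm_div, Algebra.norm_algebraMap, hm, mul_pow, ← htz,
      mul_div_cancel_right₀ _ hs0]
    exact hz
  have hu2 := algebraMap_mem_of_isIntegral (fun x hx => (hO x).2 hx) huint
  have hv2 := algebraMap_mem_of_isIntegral (fun x hx => (hO x).2 hx) hvint
  obtain ⟨r, hr, w, hw, hrw⟩ := h₁.exists_residue h₂ (m + 2) hu2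
  have hp0 : O₂.valuation (p : K₂) ≠ 0 := by simpa using hp2
  have hvalu : O₂.valuation (p : K₂) ≤ O₂.valuation (algebraMap F K₂ u) := by
    rw [← O₂.valuation_le_one_iff, map_div₀, map_div₀, map_natCast] at hv2
    exact (div_le_one₀ (zero_lt_iff.2 (by simpa using hu0))).1 hv2
  have hvalw : O₂.valuation ((p : K₂) ^ (m + 2) * w) < O₂.valuation (p : K₂) := by
    have h1 := (O₂.valuation_le_one_iff w).2 hw
    calc O₂.valuation ((p : K₂) ^ (m + 2) * w)
        = O₂.valuation (p : K₂) ^ (m + 2) * O₂.valuation w := by rw [map_mul, map_pow]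
      _ ≤ O₂.valuation (p : K₂) ^ (m + 2) := mul_le_of_le_one_right' h1
      _ < O₂.valuation (p : K₂) ^ 1 :=
          pow_lt_pow_right_of_lt_one₀ (zero_lt_iff.2 hp0) hval (by omega)
      _ = _ := pow_one _
  have hvalr : O₂.valuation (p : K₂) ≤ O₂.valuation (algebraMap K₁ K₂ r) := by
    have h1 : algebraMap F K₂ u = algebraMap K₁ K₂ r + (p : K₂) ^ (m + 2) * w := by
      linear_combination -hrw
    by_contra! hcon
    refine absurd hvalu (not_le.2 ?_)
    rw [h1]
    exact O₂.valuation.map_add_lt hcon hvalw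
  have hr0 : r ≠ 0 := by
    rintro rfl
    rw [map_zero, map_zero, le_zero_iff] at hvalr
    exact hp0 hvalr
  have hpr : (p : K₁) / r ∈ O₁ := by
    rw [← SetLike.mem_coe, ← hO, map_div₀, map_natCast, SetLike.mem_coe,
      ← O₂.valuation_le_one_iff, map_div₀]
    exact (div_le_one₀ (zero_lt_iff.2 (by simpa using hr0))).2 hvalr
  set w' : F := (u - algebraMap K₁ F r) / (p : F) ^ (m + 2) with hw'
  have hww : algebraMap F K₂ w' = w := by
    rw [hw', map_div₀, map_sub, ← IsScalarTower.algebraMap_apply, map_pow, map_natCast, ← hrw,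
      mul_div_cancel_left₀ _ (pow_ne_zero _ hp2)]
  have hwint : IsIntegral O₁ w' :=
    isIntegral_of_algebraMap_mem hcc hO (by rw [hww]; exact hw)
  have htr : Algebra.trace K₁ F w' ∈ O₁ := mem_of_isIntegral (Algebra.isIntegral_trace hwint)
  have htu : Algebra.trace K₁ F u = 0 := by
    have h1 : u = t⁻¹ • b := by
      rw [hu, Algebra.smul_def, map_inv₀, div_eq_inv_mul]
    rw [h1, map_smul, hb, smul_zero]
  have hkey : (p : K₁) ^ (m + 2) * Algebra.trace K₁ F w' = -((m + 1 : ℕ) * r) := by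
    have h1 : (p : K₁) ^ (m + 2) • w' = u - algebraMap K₁ F r := by
      rw [Algebra.smul_def, map_pow, map_natCast, hw', mul_div_cancel₀ _ (pow_ne_zero _ hpF)]
    have h2 := congrArg (Algebra.trace K₁ F) h1
    rw [map_smul, map_sub, htu, Algebra.trace_algebraMap, hm, nsmul_eq_mul, smul_eq_mul] at h2
    rw [h2, zero_sub]
  refine h₁.pow_mul_ne (m + 1) m.succ_pos (-(Algebra.trace K₁ F w' * (p / r)))
    (O₁.neg_mem _ (O₁.mul_mem _ _ htr hpr)) ?_
  field_simp
  linear_combination -hkey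

/-- `K₁` is relatively algebraically closed in `K₂`. -/
theorem IsPadicLike.mem_range_of_isIntegral [Fact p.Prime] (h₁ : IsPadicLike p n d N K₁ O₁)
    (h₂ : IsPadicLike p n d N K₂ O₂) {a : K₂} (ha : IsIntegral K₁ a) :
    a ∈ Set.range (algebraMap K₁ K₂) := by
  have := h₁.charZero
  have : FiniteDimensional K₁ (IntermediateField.adjoin K₁ {a}) :=
    IntermediateField.adjoin.finiteDimensional ha
  set F := IntermediateField.adjoin K₁ {a}
  set g : F := IntermediateField.AdjoinSimple.gen K₁ a
  set c : K₁ := Algebra.trace K₁ F g / Module.finrank K₁ F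
  have hm : (Module.finrank K₁ F : K₁) ≠ 0 := by
    exact_mod_cast (Module.finrank_pos (R := K₁) (M := F)).ne'
  have h0 : g - algebraMap K₁ F c = 0 := by
    refine h₁.eq_zero_of_trace_eq_zero h₂ ?_
    rw [map_sub, Algebra.trace_algebraMap, nsmul_eq_mul, mul_div_cancel₀ _ hm, sub_self]
  refine ⟨c, ?_⟩
  rw [IsScalarTower.algebraMap_apply K₁ F K₂, ← sub_eq_zero.1 h0]
  exact IntermediateField.AdjoinSimple.algebraMap_gen K₁ a

end Pair

/-! ### The valuation ring of a finite extension of `ℚ_p` -/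

section Padic

variable (p : ℕ) [Fact p.Prime]

/-- The ring `ℤ_p` as a valuation subring of `ℚ_p`. -/
noncomputable def padicUnitBall : ValuationSubring ℚ_[p] where
  carrier := {x | ‖x‖ ≤ 1}
  one_mem' := norm_one.le
  zero_mem' := norm_zero.trans_le zero_le_one
  mul_mem' {x y} hx hy := (norm_mul x y).trans_le (mul_le_one₀ hx (norm_nonneg y) hy)
  add_mem' {x y} hx hy := (Padic.nonarchimedean x y).trans (max_le hx hy)
  neg_mem' {x} hx := (norm_neg x).trans_le hx
  mem_or_inv_mem' x := by
    rcases le_total ‖x‖ 1 with h | h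
    · exact Or.inl h
    · right
      change ‖x⁻¹‖ ≤ 1
      rw [norm_inv]
      exact inv_le_one_of_one_le₀ h

variable {p}

/-- The spectral norm of an algebraic element is a power of the norm of the constant coefficient of
its minimal polynomial, and bounds all the other coefficients. -/
theorem constantCoeffProperty_padicUnitBall : ConstantCoeffProperty (padicUnitBall p) := by
  intro f hf hirr h0
  obtain ⟨F, _, _, a, _, hmin, -, -⟩ := exists_finite_extension_root hf hirr
  have h1 : spectralNorm ℚ_[p] F a ≤ 1 := by
    rw [spectralNorm.spectralNorm_eq_norm_coeff_zero_rpow, hmin]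
    exact Real.rpow_le_one (norm_nonneg _) h0 (by positivity)
  rw [spectralNorm, hmin] at h1
  exact (spectralValue_le_one_iff hf).1 h1

end Padic

theorem natCast_prime_ne_zero (p : ℕ) [Fact p.Prime] (L : Type*) [Field L]
    [Algebra ℚ_[p] L] : (p : L) ≠ 0 := by
  have : CharZero L := charZero_of_injective_algebraMap (algebraMap ℚ_[p] L).injective
  exact_mod_cast (Fact.out : p.Prime).ne_zero

theorem zpow_prime_right_injective (p : ℕ) [Fact p.Prime] :
    Function.Injective fun e : ℤ => (p : ℝ) ^ e :=
  zpow_right_injective₀ (by exact_mod_cast (Fact.out : p.Prime).pos)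
    (by exact_mod_cast (Fact.out : p.Prime).ne_one)

theorem one_lt_prime_cast (p : ℕ) [Fact p.Prime] : (1 : ℝ) < p := by
  exact_mod_cast (Fact.out : p.Prime).one_lt

section Extension

variable (p : ℕ) [Fact p.Prime] (L : Type*) [Field L] [Algebra ℚ_[p] L] [FiniteDimensional ℚ_[p] L]

/-- The elements of a finite extension of `ℚ_p` with norm in `ℤ_p`, as a valuation subring. -/
noncomputable def integerRing : ValuationSubring L where
  carrier := {x | ‖Algebra.norm ℚ_[p] x‖ ≤ 1}
  one_mem' := by simp
  zero_mem' := by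
    change ‖Algebra.norm ℚ_[p] (0 : L)‖ ≤ 1
    simp [Algebra.norm_zero]
  mul_mem' {x y} hx hy := by
    change ‖Algebra.norm ℚ_[p] (x * y)‖ ≤ 1
    rw [map_mul, norm_mul]
    exact mul_le_one₀ hx (norm_nonneg _) hy
  add_mem' {x y} hx hy := by
    have h := constantCoeffProperty_padicUnitBall (p := p)
    exact h.isIntegral_iff.1 ((h.isIntegral_iff.2 hx).add (h.isIntegral_iff.2 hy))
  neg_mem' {x} hx := by
    have h := constantCoeffProperty_padicUnitBall (p := p)
    exact h.isIntegral_iff.1 (h.isIntegral_iff.2 hx).neg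
  mem_or_inv_mem' x := by
    rcases eq_or_ne x 0 with rfl | hx
    · left
      change ‖Algebra.norm ℚ_[p] (0 : L)‖ ≤ 1
      simp [Algebra.norm_zero]
    rcases le_total ‖Algebra.norm ℚ_[p] x‖ 1 with h | h
    · exact Or.inl h
    · right
      change ‖Algebra.norm ℚ_[p] x⁻¹‖ ≤ 1
      rw [← one_div, norm_div, map_one, one_div, norm_inv]
      exact inv_le_one_of_one_le₀ h

variable {p L}

theorem mem_integerRing {x : L} : x ∈ integerRing p L ↔ ‖Algebra.norm ℚ_[p] x‖ ≤ 1 := Iff.rfl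

theorem mem_integerRing_iff_isIntegral {x : L} :
    x ∈ integerRing p L ↔ IsIntegral (padicUnitBall p) x :=
  constantCoeffProperty_padicUnitBall.isIntegral_iff.symm

variable (p L) in
theorem coe_integerRing : (integerRing p L : Set L) = valRing p L := by
  ext x
  rw [SetLike.mem_coe, mem_integerRing_iff_isIntegral]
  constructor
  · rintro ⟨q, hq, hroot⟩
    let φ : padicUnitBall p →+* ℤ_[p] :=
      { toFun := fun y => ⟨y.1, y.2⟩
        map_one' := rfl
        map_zero' := rfl
        map_mul' := fun _ _ => rfl
        map_add' := fun _ _ => rfl }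
    refine ⟨q.map φ, hq.map φ, ?_⟩
    rw [eval₂_map]
    exact hroot
  · rintro ⟨q, hq, hroot⟩
    let φ : ℤ_[p] →+* padicUnitBall p :=
      { toFun := fun y => ⟨y.1, y.2⟩
        map_one' := rfl
        map_zero' := rfl
        map_mul' := fun _ _ => rfl
        map_add' := fun _ _ => rfl }
    refine ⟨q.map φ, hq.map φ, ?_⟩
    rw [eval₂_map]
    exact hroot

/-- For a root `a` of an irreducible polynomial over `L`, the norm of `a` down to `ℚ_p` is computed
from the constant coefficient. -/
theorem constantCoeffProperty_integerRing : ConstantCoeffProperty (integerRing p L) := by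
  intro f hf hirr h0
  obtain ⟨F, _, _, a, _, hmin, -, hN⟩ := exists_finite_extension_root hf hirr
  let _ : Algebra ℚ_[p] F := ((algebraMap L F).comp (algebraMap ℚ_[p] L)).toAlgebra
  have : IsScalarTower ℚ_[p] L F := IsScalarTower.of_algebraMap_eq' rfl
  have : FiniteDimensional ℚ_[p] F := FiniteDimensional.trans ℚ_[p] L F
  have ha : IsIntegral (padicUnitBall p) a := by
    rw [constantCoeffProperty_padicUnitBall.isIntegral_iff, ← Algebra.norm_norm (S := L), hN]
    exact (neg_one_pow_mul_mem_iff (O := integerRing p L) _ _).2 h0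
  have ha' : IsIntegral (integerRing p L) a := by
    obtain ⟨q, hq, hroot⟩ := ha
    let φ : padicUnitBall p →+* integerRing p L :=
      ((algebraMap ℚ_[p] L).comp (padicUnitBall p).subtype).codRestrict (integerRing p L)
        fun y => by
          rw [mem_integerRing_iff_isIntegral]
          exact isIntegral_algebraMap (R := padicUnitBall p) (A := L) (x := y)
    refine ⟨q.map φ, hq.map φ, ?_⟩
    rw [eval₂_map]
    exact hroot
  intro i
  rw [← hmin, minpoly.isIntegrallyClosed_eq_field_fractions' L ha', coeff_map]
  exact ((minpoly (integerRing p L) a).coeff i).2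

theorem integerRing_valuation_le_iff {x y : L} :
    (integerRing p L).valuation x ≤ (integerRing p L).valuation y ↔
      ‖Algebra.norm ℚ_[p] x‖ ≤ ‖Algebra.norm ℚ_[p] y‖ := by
  rcases eq_or_ne y 0 with rfl | hy
  · simp [Algebra.norm_zero, Algebra.norm_eq_zero_iff]
  have h1 : (0 : ℝ) < ‖Algebra.norm ℚ_[p] y‖ :=
    norm_pos_iff.2 (Algebra.norm_ne_zero_iff.2 hy)
  rw [← div_le_one₀ h1, ← _root_.norm_div, ← norm_div, ← mem_integerRing,
    ← ValuationSubring.valuation_le_one_iff, map_div₀,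
    div_le_one₀ (zero_lt_iff.2 (by simpa using hy))]

theorem integerRing_valuation_lt_one_iff {x : L} :
    (integerRing p L).valuation x < 1 ↔ ‖Algebra.norm ℚ_[p] x‖ < 1 := by
  rw [← not_le, ← not_le, ← map_one (integerRing p L).valuation, integerRing_valuation_le_iff]
  simp

theorem norm_eq_of_integerRing_valuation_eq {x y : L}
    (h : (integerRing p L).valuation x = (integerRing p L).valuation y) :
    ‖Algebra.norm ℚ_[p] x‖ = ‖Algebra.norm ℚ_[p] y‖ :=
  le_antisymm (integerRing_valuation_le_iff.1 h.le) (integerRing_valuation_le_iff.1 h.ge)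

theorem exists_norm_eq_zpow {x : L} (hx : x ≠ 0) :
    ∃ e : ℤ, ‖Algebra.norm ℚ_[p] x‖ = (p : ℝ) ^ e :=
  ⟨_, Padic.norm_eq_zpow_neg_valuation (Algebra.norm_ne_zero_iff.2 hx)⟩

theorem norm_norm_natCast (m : ℕ) :
    ‖Algebra.norm ℚ_[p] (m : L)‖ = ‖(m : ℚ_[p])‖ ^ Module.finrank ℚ_[p] L := by
  rw [← map_natCast (algebraMap ℚ_[p] L), Algebra.norm_algebraMap, norm_pow]

theorem norm_norm_prime :
    ‖Algebra.norm ℚ_[p] (p : L)‖ = (p : ℝ) ^ (-(Module.finrank ℚ_[p] L : ℤ)) := by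
  rw [norm_norm_natCast, Padic.norm_p, inv_pow, zpow_neg, zpow_natCast]

end Extension

section Extension

variable {p : ℕ} [Fact p.Prime] {L : Type*} [Field L] [Algebra ℚ_[p] L] [FiniteDimensional ℚ_[p] L]

theorem hasFiniteQuotients_padicInt : Ring.HasFiniteQuotients ℤ_[p] where
  finiteQuotient {I} hI := by
    obtain ⟨n, rfl⟩ := PadicInt.ideal_eq_span_pow_p hI
    have : NeZero (p ^ n) := ⟨pow_ne_zero _ (Fact.out : p.Prime).ne_zero⟩
    rw [← PadicInt.ker_toZModPow]
    exact Finite.of_injective _ (RingHom.kerLift_injective (PadicInt.toZModPow (p := p) n))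

variable (p L) in
/-- The valuation ring is a finite `ℤ_p`-module, so its quotients by nonzero ideals are finite. -/
theorem integerRing_exists_residues (k : ℕ) : ∃ (M : ℕ) (r : Fin M → L),
    (∀ i, r i ∈ integerRing p L) ∧
    (∀ i j, i ≠ j → ∀ y ∈ integerRing p L, (p : L) ^ k * y ≠ r i - r j) ∧
    ∀ x ∈ integerRing p L, ∃ i, ∃ y ∈ integerRing p L, (p : L) ^ k * y = x - r i := by
  let _ : Algebra ℤ_[p] L := ((algebraMap ℚ_[p] L).comp (algebraMap ℤ_[p] ℚ_[p])).toAlgebra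
  have : IsScalarTower ℤ_[p] ℚ_[p] L := IsScalarTower.of_algebraMap_eq' rfl
  have : CharZero L := charZero_of_injective_algebraMap (algebraMap ℚ_[p] L).injective
  let C := integralClosure ℤ_[p] L
  have hmem : ∀ x : L, x ∈ C ↔ x ∈ integerRing p L := by
    intro x
    rw [← SetLike.mem_coe, ← SetLike.mem_coe (p := integerRing p L), coe_integerRing]
    rfl
  have : Module.Finite ℤ_[p] C := IsIntegralClosure.finite ℤ_[p] ℚ_[p] L C
  have := hasFiniteQuotients_padicInt (p := p)
  have hC : Ring.HasFiniteQuotients C := Ring.HasFiniteQuotients.of_module_finite ℤ_[p] C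
  let J : Ideal C := Ideal.span {(p : C) ^ k}
  have hJ : J ≠ ⊥ := by
    simp only [J, ne_eq, Ideal.span_singleton_eq_bot]
    exact pow_ne_zero _ (by exact_mod_cast (Fact.out : p.Prime).ne_zero)
  have : Finite (C ⧸ J) := hC.finiteQuotient hJ
  let e := (Finite.equivFin (C ⧸ J)).symm
  let r : Fin (Nat.card (C ⧸ J)) → C := fun i => Quotient.out (e i)
  have hr : ∀ i, Ideal.Quotient.mk J (r i) = e i := fun i => Quotient.out_eq (e i)
  refine ⟨_, fun i => r i, fun i => (hmem _).1 (r i).2, ?_, ?_⟩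
  · intro i j hij y hy hxy
    refine hij (e.injective ?_)
    rw [← hr i, ← hr j, Ideal.Quotient.eq, Ideal.mem_span_singleton]
    exact ⟨⟨y, (hmem y).2 hy⟩, Subtype.ext (by simpa using hxy.symm)⟩
  · intro x hx
    let x' : C := ⟨x, (hmem x).2 hx⟩
    obtain ⟨i, hi⟩ := e.surjective (Ideal.Quotient.mk J x')
    rw [← hr i, eq_comm, Ideal.Quotient.eq, Ideal.mem_span_singleton] at hi
    obtain ⟨y, hy⟩ := hi
    exact ⟨i, y, (hmem y).1 y.2, by simpa using (congrArg Subtype.val hy).symm⟩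

theorem integerRing_exists_root_approx (m : ℕ) {s : L} (hs : s ≠ 0) :
    ∃ t y z : L, t ≠ 0 ∧ y ∈ integerRing p L ∧ z ∈ integerRing p L ∧ y * t ^ (m + 1) = s ∧
      z * s = p ^ (m + 1) * t ^ (m + 1) := by
  set d := Module.finrank ℚ_[p] L with hd
  have hdpos : 0 < d := Module.finrank_pos
  have hp0 := natCast_prime_ne_zero p L
  have hp1 := one_lt_prime_cast p
  obtain ⟨e, he⟩ := exists_norm_eq_zpow (p := p) hs
  -- `t` is the power of `p` whose exponent is the integral part of `v(s) / (m + 1)`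
  set i : ℤ := -e / (d * (m + 1) : ℕ) with hi
  set t : L := (p : L) ^ i
  have ht0 : t ≠ 0 := zpow_ne_zero _ hp0
  have htn : ‖Algebra.norm ℚ_[p] (t ^ (m + 1))‖ = (p : ℝ) ^ (-((d * (m + 1) : ℕ) * i)) := by
    have h1 : t ^ (m + 1) = algebraMap ℚ_[p] L ((p : ℚ_[p]) ^ (i * (m + 1 : ℕ))) := by
      rw [map_zpow₀, map_natCast, zpow_mul, zpow_natCast]
    rw [h1, Algebra.norm_algebraMap, norm_pow, Padic.norm_p_zpow, ← hd, ← zpow_natCast, ← zpow_mul]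
    congr 1
    push_cast
    ring
  have hdm : (0 : ℤ) < (d * (m + 1) : ℕ) := by positivity
  refine ⟨t, s / t ^ (m + 1), p ^ (m + 1) * t ^ (m + 1) / s, ht0, ?_, ?_,
    div_mul_cancel₀ _ (pow_ne_zero _ ht0), div_mul_cancel₀ _ hs⟩
  · rw [mem_integerRing, norm_div, _root_.norm_div, he, htn,
      ← zpow_sub₀ (zero_lt_one.trans hp1).ne']
    refine zpow_le_one_of_nonpos₀ hp1.le ?_
    have := Int.mul_ediv_self_le (x := -e) hdm.ne'
    rw [hi]
    linarith
  · rw [mem_integerRing, norm_div, _root_.norm_div, he, map_mul, norm_mul, htn, map_pow, norm_pow,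
      norm_norm_prime, ← hd, ← zpow_natCast, ← zpow_mul,
      ← zpow_add₀ (zero_lt_one.trans hp1).ne', ← zpow_sub₀ (zero_lt_one.trans hp1).ne']
    refine zpow_le_one_of_nonpos₀ hp1.le ?_
    have := Int.lt_mul_ediv_self_add (x := -e) hdm
    rw [← hi] at this
    push_cast at this ⊢
    linarith

theorem integerRing_pow_mul_ne {m : ℕ} (hm : 0 < m) {y : L} (hy : y ∈ integerRing p L) :
    (p : L) ^ m * y ≠ m := by
  intro h
  set d := Module.finrank ℚ_[p] L with hd
  have hd0 : d ≠ 0 := (Module.finrank_pos).ne'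
  have h1 := congrArg (fun x => ‖Algebra.norm ℚ_[p] x‖) h
  simp only [map_mul, norm_mul] at h1
  rw [map_pow, norm_pow, norm_norm_natCast, norm_norm_natCast, ← hd, ← pow_mul, mul_comm d m,
    pow_mul] at h1
  have h2 : ‖(m : ℚ_[p])‖ ≤ ‖(p : ℚ_[p])‖ ^ m := by
    refine le_of_pow_le_pow_left₀ hd0 (by positivity) ?_
    rw [← h1]
    exact mul_le_of_le_one_right (by positivity) hy
  rw [← norm_pow, Padic.norm_p_pow] at h2
  have h3 := (Padic.norm_int_le_pow_iff_dvd (p := p) (m : ℤ) m).1 (by exact_mod_cast h2)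
  have h4 : p ^ m ∣ m := by exact_mod_cast h3
  exact absurd (Nat.le_of_dvd hm h4) (not_le.2 (Nat.lt_pow_self (Fact.out : p.Prime).one_lt))

end Extension

/-! ### Definitions of the valuation ring with one quantifier -/

section Definability

variable {p n : ℕ} [Fact p.Prime] {L : Type*} [Field L] [Algebra ℚ_[p] L]
  [FiniteDimensional ℚ_[p] L]

/-- By Hensel's lemma `1 + p * x ^ n` is an `n`-th power for integral `x`; otherwise its valuation
is that of `p * x ^ n`, which is not divisible by `n`. -/
theorem mem_integerRing_iff_exists (hn : n.Prime) (hpn : p < n)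
    (hd : Module.finrank ℚ_[p] L < n) (x : L) :
    x ∈ integerRing p L ↔ ∃ z : L, z ^ n = 1 + p * x ^ n := by
  set O := integerRing p L
  set d := Module.finrank ℚ_[p] L
  have hdpos : 0 < d := Module.finrank_pos
  have hp1 := one_lt_prime_cast p
  have hpr0 : (p : ℝ) ≠ 0 := (zero_lt_one.trans hp1).ne'
  have hndvd : ¬ (n : ℤ) ∣ d := fun h =>
    absurd (Nat.le_of_dvd hdpos (by exact_mod_cast h)) (not_le.2 hd)
  constructor
  · intro hx
    have hhens : HenselianLocalRing O := constantCoeffProperty_integerRing.henselianLocalRing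
    let ξ : O := ⟨x, hx⟩
    have hpmax : (p : O) ∈ IsLocalRing.maximalIdeal O := by
      rw [ValuationSubring.valuation_lt_one_iff, integerRing_valuation_lt_one_iff]
      rw [show ((p : O) : L) = (p : L) from map_natCast O.subtype p, norm_norm_prime]
      exact zpow_lt_one_of_neg₀ hp1 (by simpa using hdpos)
    have hnunit : IsUnit (n : O) := by
      have hcast : ((n : O) : L) = (n : L) := map_natCast O.subtype n
      have hn1 : ‖(n : ℚ_[p])‖ = 1 := by
        rw [Padic.norm_natCast_eq_one_iff]
        exact (Nat.coprime_primes Fact.out hn).2 hpn.ne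
      rw [ValuationSubring.valuation_eq_one_iff, hcast]
      refine le_antisymm ?_ ?_
      · rw [← map_one O.valuation, integerRing_valuation_le_iff, norm_norm_natCast, hn1]
        simp
      · rw [← map_one O.valuation, integerRing_valuation_le_iff, norm_norm_natCast, hn1]
        simp
    obtain ⟨z, hz, -⟩ := hhens.is_henselian (X ^ n - C (1 + p * ξ ^ n))
      (monic_X_pow_sub_C _ hn.ne_zero) 1 (by
        have : eval 1 (X ^ n - C (1 + (p : O) * ξ ^ n)) = p * (-ξ ^ n) := by
          rw [eval_sub, eval_pow, eval_X, eval_C]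
          ring
        rw [this]
        exact Ideal.mul_mem_right _ _ hpmax) (by
        rw [derivative_sub, derivative_C, sub_zero, derivative_X_pow]
        simpa using hnunit)
    refine ⟨z, ?_⟩
    rw [IsRoot.def, eval_sub, eval_pow, eval_X, eval_C, sub_eq_zero] at hz
    simpa [ξ] using congrArg O.subtype hz
  · rintro ⟨z, hz⟩
    by_contra hx
    have hx0 : x ≠ 0 := by
      rintro rfl
      exact hx O.zero_mem
    obtain ⟨e, he⟩ := exists_norm_eq_zpow (p := p) hx0
    have hepos : 0 < e := by
      rw [mem_integerRing, he, not_le] at hx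
      exact (one_lt_zpow_iff_right₀ hp1).1 hx
    have hnorm : ‖Algebra.norm ℚ_[p] ((p : L) * x ^ n)‖ = (p : ℝ) ^ (-(d : ℤ) + e * n) := by
      rw [map_mul, norm_mul, norm_norm_prime, map_pow, norm_pow, he, ← zpow_natCast, ← zpow_mul,
        ← zpow_add₀ hpr0]
    have hlt : O.valuation 1 < O.valuation ((p : L) * x ^ n) := by
      rw [← not_le, integerRing_valuation_le_iff, not_le, hnorm, map_one, norm_one]
      refine one_lt_zpow₀ hp1 ?_
      have h1 : (d : ℤ) < n := by exact_mod_cast hd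
      nlinarith
    have hz1 := norm_eq_of_integerRing_valuation_eq (O.valuation.map_add_eq_of_lt_right hlt)
    rw [← hz, hnorm, map_pow, norm_pow] at hz1
    have hz0 : z ≠ 0 := by
      rintro rfl
      rw [Algebra.norm_zero, norm_zero, zero_pow hn.ne_zero] at hz1
      exact (zpow_ne_zero _ hpr0) hz1.symm
    obtain ⟨f, hf⟩ := exists_norm_eq_zpow (p := p) hz0
    rw [hf, ← zpow_natCast, ← zpow_mul] at hz1
    have h2 := zpow_prime_right_injective p hz1
    exact hndvd ⟨e - f, by linear_combination h2⟩

/-- Here `d` is the degree of `L`. For integral `x` the right hand side is a unit, but `n` does not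
divide the valuation of the norm of `p ^ (n - 1)`, so the left hand side is never a unit. For other
`x` the element `y = x ^ (-d) / p` is integral, and an `n`-th root `z` of `1 + p * y ^ n` yields the
solution `w = x ^ d * z`. -/
theorem mem_integerRing_iff_forall (hn : n.Prime) (hpn : p < n)
    (hd : Module.finrank ℚ_[p] L < n) (x : L) :
    x ∈ integerRing p L ↔ ∀ w : L,
      ¬ ((p : L) ^ (n - 1) * w ^ n = 1 + p ^ (n - 1) * x ^ (Module.finrank ℚ_[p] L * n)) := by
  set O := integerRing p L
  set d := Module.finrank ℚ_[p] L
  have hdpos : 0 < d := Module.finrank_pos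
  have hp1 := one_lt_prime_cast p
  have hp0 := natCast_prime_ne_zero p L
  have hpr0 : (p : ℝ) ≠ 0 := (zero_lt_one.trans hp1).ne'
  have hndvd : ¬ (n : ℤ) ∣ d := fun h =>
    absurd (Nat.le_of_dvd hdpos (by exact_mod_cast h)) (not_le.2 hd)
  obtain ⟨k, hk⟩ : ∃ k, n = k + 1 := Nat.exists_eq_succ_of_ne_zero hn.ne_zero
  have hk0 : 0 < k := by
    have := hn.two_le
    omega
  have hk1 : n - 1 = k := by omega
  have hpk : ‖Algebra.norm ℚ_[p] ((p : L) ^ k)‖ = (p : ℝ) ^ (-(d : ℤ) * k) := by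
    rw [map_pow, norm_pow, norm_norm_prime, ← zpow_natCast, ← zpow_mul]
  rw [hk1]
  constructor
  · intro hx w hw
    have hlt : O.valuation ((p : L) ^ k * x ^ (d * n)) < O.valuation 1 := by
      rw [← not_le, integerRing_valuation_le_iff, not_le, map_one, norm_one, map_mul, norm_mul]
      refine mul_lt_one_of_nonneg_of_lt_one_left (norm_nonneg _) ?_ (pow_mem hx (d * n) : _ ∈ O)
      rw [hpk]
      refine zpow_lt_one_of_neg₀ hp1 ?_
      have : (0 : ℤ) < d * k := by positivity
      linarith
    have hw1 := norm_eq_of_integerRing_valuation_eq (O.valuation.map_add_eq_of_lt_left hlt)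
    rw [← hw, map_mul, norm_mul, hpk, map_pow, norm_pow, map_one, norm_one] at hw1
    have hw0 : w ≠ 0 := by
      rintro rfl
      simp [Algebra.norm_zero, hn.ne_zero] at hw1
    obtain ⟨f, hf⟩ := exists_norm_eq_zpow (p := p) hw0
    rw [hf, ← zpow_natCast, ← zpow_mul, ← zpow_add₀ hpr0, ← zpow_zero (p : ℝ)] at hw1
    have h2 := zpow_prime_right_injective p hw1
    refine hndvd ⟨d - f, ?_⟩
    rw [hk] at h2 ⊢
    push_cast at h2 ⊢
    linear_combination h2
  · intro h
    by_contra hx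
    have hx0 : x ≠ 0 := by
      rintro rfl
      exact hx O.zero_mem
    obtain ⟨e, he⟩ := exists_norm_eq_zpow (p := p) hx0
    have hepos : 0 < e := by
      rw [mem_integerRing, he, not_le] at hx
      exact (one_lt_zpow_iff_right₀ hp1).1 hx
    have hy : 1 / (x ^ d * p) ∈ O := by
      rw [mem_integerRing, norm_div, _root_.norm_div, map_one, norm_one, map_mul, norm_mul, map_pow,
        norm_pow, he, norm_norm_prime, ← zpow_natCast, ← zpow_mul, ← zpow_add₀ hpr0, one_div]
      refine inv_le_one_of_one_le₀ (one_le_zpow₀ hp1.le ?_)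
      nlinarith
    obtain ⟨z, hz⟩ := (mem_integerRing_iff_exists hn hpn hd _).1 hy
    refine h (x ^ d * z) ?_
    have hpn' : (p : L) ^ n = p ^ k * p := by rw [hk, pow_succ]
    have hxn : (x ^ d) ^ n ≠ 0 := pow_ne_zero _ (pow_ne_zero _ hx0)
    rw [mul_pow, hz, one_div, inv_pow, mul_pow (x ^ d), hpn', pow_mul]
    field_simp
    ring

variable (L) in
theorem exists_isPadicLike_integerRing (hn : n.Prime) (hpn : p < n)
    (hd : Module.finrank ℚ_[p] L < n) :
    ∃ N : ℕ → ℕ, IsPadicLike p n (Module.finrank ℚ_[p] L) N L (integerRing p L) := by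
  choose N hN using integerRing_exists_residues p L
  exact ⟨N, {
    one_mem := (integerRing p L).one_mem
    neg_mem := fun x => (integerRing p L).neg_mem x
    add_mem := fun x hx y hy => (integerRing p L).add_mem x y hx hy
    mul_mem := fun x hx y hy => (integerRing p L).mul_mem x y hx hy
    mem_or_mem := fun x y hxy => by
      rw [← inv_eq_of_mul_eq_one_right hxy]
      exact (integerRing p L).mem_or_inv_mem x
    mem_iff_exists := mem_integerRing_iff_exists hn hpn hd
    mem_iff_forall := mem_integerRing_iff_forall hn hpn hd
    mem_or_factor := constantCoeffProperty_integerRing.mem_or_factor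
    exists_root_approx := fun m s hs => integerRing_exists_root_approx m hs
    residues := hN
    pow_mul_ne := fun m hm y hy => integerRing_pow_mul_ne hm hy }⟩

end Definability

/-! ### The defining formulas -/

/-- The existential formula `∃ z, z ^ n = 1 + p * x ^ n`. -/
noncomputable def existsFormula (p n : ℕ) : Language.ring.Formula (Fin 1) :=
  (Term.bdEqual (n := 1)
    (termOfFreeCommRing (FreeCommRing.of (Sum.inr 0) ^ n : FreeCommRing (Fin 1 ⊕ Fin 1)))
    (termOfFreeCommRing (1 + (p : FreeCommRing (Fin 1 ⊕ Fin 1)) *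
      FreeCommRing.of (Sum.inl 0) ^ n))).ex

/-- The universal formula `∀ w, p ^ (n - 1) * w ^ n ≠ 1 + p ^ (n - 1) * x ^ (d * n)`. -/
noncomputable def forallFormula (p n d : ℕ) : Language.ring.Formula (Fin 1) :=
  (Term.bdEqual (n := 1)
    (termOfFreeCommRing ((p : FreeCommRing (Fin 1 ⊕ Fin 1)) ^ (n - 1) *
      FreeCommRing.of (Sum.inr 0) ^ n))
    (termOfFreeCommRing (1 + (p : FreeCommRing (Fin 1 ⊕ Fin 1)) ^ (n - 1) *
      FreeCommRing.of (Sum.inl 0) ^ (d * n)))).not.all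

theorem isExistential_existsFormula (p n : ℕ) : BoundedFormula.IsExistential (existsFormula p n) :=
  .ex (BoundedFormula.IsAtomic.equal _ _).isExistential

theorem isUniversal_forallFormula (p n d : ℕ) :
    BoundedFormula.IsUniversal (forallFormula p n d) :=
  .all (BoundedFormula.IsAtomic.equal _ _).isQF.not.isUniversal

section Realize

variable {K : Type*} [Field K] [CompatibleRing K]

theorem definedSet_existsFormula (p n : ℕ) :
    definedSet (existsFormula p n) K = {x | ∃ z : K, z ^ n = 1 + p * x ^ n} := by
  ext x
  simp [definedSet, existsFormula, Formula.Realize, Fin.snoc]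

theorem definedSet_forallFormula (p n d : ℕ) :
    definedSet (forallFormula p n d) K =
      {x | ∀ w : K, ¬ (p ^ (n - 1) * w ^ n = 1 + p ^ (n - 1) * x ^ (d * n))} := by
  ext x
  simp [definedSet, forallFormula, Formula.Realize, Fin.snoc]

end Realize

end PadicFieldTheory

/-! ### Models of the theory of `L` -/

theorem mainTheorem3 {p : ℕ} [Fact p.Prime] (L : Type*) [Field L] [CompatibleRing L]
    [Algebra ℚ_[p] L] [FiniteDimensional ℚ_[p] L] :
    -- an existential formula of the language of rings defines the valuation ring of `L`
    (∃ ψ : Language.ring.Formula (Fin 1), BoundedFormula.IsExistential ψ ∧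
      PadicFieldTheory.definedSet ψ L = PadicFieldTheory.valRing p L) ∧
    -- fix any formula `ψ` defining it; for models `K` of `Th(L)`, `𝒪_K` is the set `ψ(K)`
    ∀ ψ : Language.ring.Formula (Fin 1),
      PadicFieldTheory.definedSet ψ L = PadicFieldTheory.valRing p L →
      -- `𝒪_K` is a valuation ring of `K`
      (∀ (K : Type*) [Field K] [CompatibleRing K], K ⊨ Language.ring.completeTheory L →
        ∃ O : ValuationSubring K, (O : Set K) = PadicFieldTheory.definedSet ψ K) ∧
      -- embeddings `K₁ → K₂` of models of `Th(L)`
      (∀ (K₁ K₂ : Type*) [Field K₁] [CompatibleRing K₁] [Field K₂] [CompatibleRing K₂]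
        [Algebra K₁ K₂],
        K₁ ⊨ Language.ring.completeTheory L → K₂ ⊨ Language.ring.completeTheory L →
        ∀ (O₁ : ValuationSubring K₁) (O₂ : ValuationSubring K₂),
          (O₁ : Set K₁) = PadicFieldTheory.definedSet ψ K₁ →
          (O₂ : Set K₂) = PadicFieldTheory.definedSet ψ K₂ →
          algebraicClosure K₁ K₂ = ⊥ ∧
          HenselianLocalRing (O₂.comap (algebraMap K₁ K₂)) ∧
          O₂.comap (algebraMap K₁ K₂) = O₁) ∧
      -- uniform definability by a universal formula
      (∃ θ : Language.ring.Formula (Fin 1), BoundedFormula.IsUniversal θ ∧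
        ∀ (K : Type*) [Field K] [CompatibleRing K], K ⊨ Language.ring.completeTheory L →
          PadicFieldTheory.definedSet θ K = PadicFieldTheory.definedSet ψ K) := by
  open PadicFieldTheory in
  obtain ⟨n, hn_gt, hn⟩ := Nat.exists_infinite_primes (max p (Module.finrank ℚ_[p] L) + 1)
  have hpn : p < n := lt_of_le_of_lt (le_max_left _ _) hn_gt
  have hd : Module.finrank ℚ_[p] L < n := lt_of_le_of_lt (le_max_right _ _) hn_gt
  set d := Module.finrank ℚ_[p] L
  obtain ⟨N, hL⟩ := exists_isPadicLike_integerRing L hn hpn hd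
  rw [← coe_integerRing]
  refine ⟨⟨existsFormula p n, isExistential_existsFormula p n, ?_⟩, fun ψ hψ => ?_⟩
  · rw [definedSet_existsFormula]
    ext x
    exact (hL.mem_iff_exists x).symm
  rw [← hψ] at hL
  refine ⟨fun K _ _ hK => (hL.transfer hK).exists_valuationSubring, ?_,
    forallFormula p n d, isUniversal_forallFormula p n d, fun K _ _ hK => ?_⟩
  · intro K₁ K₂ _ _ _ _ _ hK₁ hK₂ O₁ O₂ hO₁ hO₂
    have h₁ : IsPadicLike p n d N K₁ O₁ := hO₁ ▸ hL.transfer hK₁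
    have h₂ : IsPadicLike p n d N K₂ O₂ := hO₂ ▸ hL.transfer hK₂
    have hcomap : O₂.comap (algebraMap K₁ K₂) = O₁ := by
      ext x
      exact h₁.algebraMap_mem_iff h₂ x
    refine ⟨?_, ?_, hcomap⟩
    · rw [eq_bot_iff]
      intro a ha
      exact IntermediateField.mem_bot.2
        (h₁.mem_range_of_isIntegral h₂ (mem_algebraicClosure_iff.1 ha).isIntegral)
    · rw [hcomap]
      exact h₁.constantCoeffProperty.henselianLocalRing
  · rw [definedSet_forallFormula]
    ext x
    exact ((hL.transfer hK).mem_iff_forall x).symm
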